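/- A function $g\colon\mathbb{Z}_{\ge 0}\to\mathbb{Z}_{\ge 0}$ is called a cardinality transformation function if for every finite set $N$ there are a finite set $W$ and a map $G\colon 2^N\to 2^W$ such that (i) $G(N)=W$, (ii) $|G(S)|=g(|S|)$ for all $S\subseteq N$, and (iii) $G(S)\cap G(T)=G(S\cap T)$ for all $S,T\subseteq N$. Theorem. Let $m$ be a composite number with exactly $r$ distinct prime factors. There is a constant $c=c(m)>0$ such that for every prime $p$ and every cardinality transformation function $g$ that satisfies, for all $x\in\mathbb{Z}_{\ge 0}$, $$g(x)\equiv\begin{cases}0 \pmod p & \text{if } x\equiv 0\pmod m,\\ 1 \pmod p & \text{if } x\not\equiv 0\pmod m,\end{cases}$$ there is a constant $\kappa\in\mathbb{Z}_{\ge 0}$ such that for all integers $n\ge\kappa$, $$g(n)\;\ge\; n^{\,c\cdot\left(\frac{\log n}{\log\log n}\right)^{r-1}}.$$ -/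

import Mathlib

/-- `G` is a `g`-realizing set transformation from the subsets of the finite ground set `N`
to the subsets of the finite set `W`: it maps `N` to `W`, it transforms cardinalities by `g`,
and it preserves intersections. -/
structure IsSetTransformation {N W : Type} [Fintype N] [DecidableEq N] [Fintype W]
    [DecidableEq W] (g : ℕ → ℕ) (G : Finset N → Finset W) : Prop where
  map_univ : G Finset.univ = Finset.univ
  card_map : ∀ S : Finset N, (G S).card = g S.card
  map_inter : ∀ S T : Finset N, G S ∩ G T = G (S ∩ T)

/-- `g` is a cardinality transformation function: every finite ground set `N` admits a
`g`-realizing set transformation into the subsets of some finite set `W`. -/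
def IsCardinalityTransformation (g : ℕ → ℕ) : Prop :=
  ∀ (N : Type) [Fintype N] [DecidableEq N],
    ∃ (W : Type) (_ : Fintype W) (_ : DecidableEq W) (G : Finset N → Finset W),
      IsSetTransformation g G

/-- The 0/1 mod-`p` property for the modulus `m`: modulo `p`, the value `g x` is `0` if
`x` is divisible by `m`, and `1` otherwise. -/
def HasZeroOneModProperty (p m : ℕ) (g : ℕ → ℕ) : Prop :=
  ∀ x : ℕ, (x ≡ 0 [MOD m] → g x ≡ 0 [MOD p]) ∧ (¬ x ≡ 0 [MOD m] → g x ≡ 1 [MOD p])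

/-!
Let `G` be a set transformation realizing `g`. Since `G` preserves intersections, every point `w`
of the target has a least set `S` with `w ∈ G S`, and inclusion-exclusion over the sets
`G (S \ {i})` shows that the number of points whose least set is a given `q`-element set is
`∑ j ≤ q, (-1) ^ j * C(q, j) * g (q - j)`. When `q` is a power of `p`, all inner binomial
coefficients vanish modulo `p`, so this number is `g q ± g 0`; when moreover `m ∤ q`, it is
`1` modulo `p`, hence nonzero. Different `q`-sets have different points, so `C(n, q) ≤ g n`
(`IsCardinalityTransformation.choose_prime_pow_le`).

Taking `q = p ^ 0 = 1` gives `n ≤ g n`, which settles the case of one prime factor. If `m` has at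
least two prime factors it divides no power of `p`, and the largest power `q` of `p` with
`2 * q ≤ n` gives `2 ^ q ≤ C(n, q) ≤ g n` with `q ≥ n / (4 * p)`. This exponential bound dominates
`n ^ ((log n / log log n) ^ (r - 1)) ≤ exp ((log n) ^ r)`.
-/

open Finset in
/-- The exact number of points of `G S` lying in none of the `G (S \ {i})`, by
inclusion-exclusion. -/
theorem IsSetTransformation.card_sdiff_biUnion_erase {N W : Type} [Fintype N] [DecidableEq N]
    [Fintype W] [DecidableEq W] {g : ℕ → ℕ} {G : Finset N → Finset W}
    (hG : IsSetTransformation g G) (S : Finset N) :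
    ((G S \ S.biUnion fun i => G (S.erase i)).card : ℤ) =
      ∑ j ∈ range (S.card + 1), S.card.choose j • ((-1 : ℤ) ^ j * g (S.card - j)) := by
  have hinf : ∀ t : Finset N, G S ∩ t.inf (fun i => G (S.erase i)) = G (S \ t) := by
    intro t
    induction t using Finset.induction_on with
    | empty => simp
    | insert a t _ ih =>
      rw [inf_insert, inf_eq_inter, inter_left_comm, ih, hG.map_inter]
      congr 1
      grind
  rw [← sum_powerset_apply_card (fun j => (-1 : ℤ) ^ j * g (S.card - j))]
  have key := inclusion_exclusion_sum_inf_compl S (fun i => G (S.erase i))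
    (fun w => if w ∈ G S then (1 : ℤ) else 0)
  have hcompl : (S.inf fun i => (G (S.erase i))ᶜ) = (S.biUnion fun i => G (S.erase i))ᶜ := by
    rw [← Finset.compl_sup, sup_eq_biUnion]
  rw [hcompl] at key
  simp only [sum_boole, filter_mem_eq_inter, smul_eq_mul] at key
  rw [inter_comm, ← sdiff_eq_inter_compl] at key
  rw [key]
  refine sum_congr rfl fun t ht => ?_
  rw [inter_comm, hinf, hG.card_map, card_sdiff_of_subset (mem_powerset.1 ht)]

open Finset in
/-- Modulo `p`, only the two outer terms of the alternating sum over row `p ^ k` of the binomial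
coefficients remain. -/
theorem dvd_alternating_sum_choose_prime_pow_sub {p : ℕ} (hp : p.Prime) (k : ℕ) (f : ℕ → ℤ) :
    (p : ℤ) ∣ ∑ j ∈ range (p ^ k + 1), (p ^ k).choose j • ((-1 : ℤ) ^ j * f (p ^ k - j)) -
      (f (p ^ k) + (-1) ^ p ^ k * f 0) := by
  obtain ⟨q, hq⟩ := Nat.exists_eq_succ_of_ne_zero (pow_pos hp.pos k).ne'
  have hdvd : ∀ j ∈ range q, p ∣ (p ^ k).choose (j + 1) := fun j hj =>
    hp.dvd_choose_pow j.succ_ne_zero (by rw [hq]; exact (Nat.succ_lt_succ (mem_range.1 hj)).ne)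
  rw [hq, Nat.succ_eq_add_one] at *
  rw [sum_range_succ, sum_range_succ']
  simp only [Nat.choose_self, Nat.choose_zero_right, one_smul, pow_zero,
    one_mul, Nat.sub_zero, Nat.sub_self, add_assoc, add_sub_cancel_right]
  refine dvd_sum fun j hj => ?_
  rw [nsmul_eq_mul]
  exact Dvd.dvd.mul_right (by exact_mod_cast hdvd j hj) _

open Finset in
/-- If every `q`-element set `S` is the least set of some point `w`, that is, `w ∈ G S` but
`w ∉ G (S \ {i})` for all `i ∈ S`, then there are at least `C(n, q)` points. -/
theorem IsSetTransformation.choose_le {N W : Type} [Fintype N] [DecidableEq N]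
    [Fintype W] [DecidableEq W] {g : ℕ → ℕ} {G : Finset N → Finset W}
    (hG : IsSetTransformation g G) {q : ℕ}
    (h : ∀ S : Finset N, S.card = q → ∃ w ∈ G S, ∀ i ∈ S, w ∉ G (S.erase i)) :
    (Fintype.card N).choose q ≤ g (Fintype.card N) := by
  choose w hw hw' using h
  have hmono : ∀ {S T : Finset N}, S ⊆ T → G S ⊆ G T := by
    intro S T hST
    rw [← inter_eq_left, hG.map_inter, inter_eq_left.2 hST]
  rw [← card_univ (α := N), ← hG.card_map univ, hG.map_univ, card_univ, card_univ,
    ← Fintype.card_finset_len]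
  refine Fintype.card_le_of_injective (fun S : {S : Finset N // S.card = q} => w S S.2) ?_
  rintro ⟨S, hS⟩ ⟨T, hT⟩ (hST : w S hS = w T hT)
  have hmem : w S hS ∈ G (S ∩ T) := by
    rw [← hG.map_inter]
    exact mem_inter.2 ⟨hw S hS, hST ▸ hw T hT⟩
  refine Subtype.ext (eq_of_subset_of_card_le (fun i hi => ?_) (hT.trans hS.symm).le)
  by_contra hiT
  refine hw' S hS i hi (hmono (fun x hx => ?_) hmem)
  rw [mem_inter] at hx
  exact mem_erase.2 ⟨fun hxi => hiT (hxi ▸ hx.2), hx.1⟩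

theorem IsCardinalityTransformation.choose_prime_pow_le {p m : ℕ} (hp : p.Prime) {g : ℕ → ℕ}
    (hg : IsCardinalityTransformation g) (h01 : HasZeroOneModProperty p m g) {k : ℕ}
    (hk : ¬ m ∣ p ^ k) (n : ℕ) : n.choose (p ^ k) ≤ g n := by
  obtain ⟨W, _, _, G, hG⟩ := hg (Fin n)
  have hle := hG.choose_le (q := p ^ k) ?_
  · simpa using hle
  intro S hS
  by_contra! hcon
  have hempty : G S \ S.biUnion (fun i => G (S.erase i)) = ∅ := by
    rw [Finset.sdiff_eq_empty_iff_subset]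
    exact fun w hw => Finset.mem_biUnion.2 (hcon w hw)
  have hcard := hG.card_sdiff_biUnion_erase S
  have hdvd := dvd_alternating_sum_choose_prime_pow_sub hp k fun j => (g j : ℤ)
  rw [hempty, hS] at hcard
  rw [← hcard, Finset.card_empty, Nat.cast_zero, zero_sub, dvd_neg] at hdvd
  have h0 : (p : ℤ) ∣ g 0 := by
    exact_mod_cast (Nat.modEq_zero_iff_dvd.1 ((h01 0).1 rfl))
  have h1 : (p : ℤ) ∣ 1 - g (p ^ k) := by
    have := (h01 (p ^ k)).2 fun h => hk (Nat.modEq_zero_iff_dvd.1 h)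
    exact_mod_cast Nat.modEq_iff_dvd.1 this
  have hone : (p : ℤ) ∣ 1 := by
    have := (h1.add hdvd).sub (h0.mul_left ((-1) ^ p ^ k))
    ring_nf at this
    exact this
  exact hp.one_lt.ne' (by exact_mod_cast Int.eq_one_of_dvd_one (by positivity) hone)

theorem Nat.two_pow_le_centralBinom (q : ℕ) : 2 ^ q ≤ q.centralBinom := by
  induction q with
  | zero => simp
  | succ q ih =>
    have := Nat.succ_mul_centralBinom_succ q
    refine le_of_mul_le_mul_left ?_ q.succ_pos
    rw [Nat.succ_eq_add_one, this, pow_succ]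
    nlinarith

/-- Consecutive powers of `p` differ by a factor of `p`, so one of them lies in
`[n / (4 * p), n / 2]`. -/
theorem Nat.exists_pow_between {p n : ℕ} (hp : 1 < p) (hn : 2 ≤ n) :
    ∃ k, 2 * p ^ k ≤ n ∧ n ≤ 4 * p * p ^ k := by
  refine ⟨Nat.log p (n / 2), ?_, ?_⟩
  · have := Nat.pow_log_le_self p (x := n / 2) (by omega)
    omega
  · have := Nat.lt_pow_succ_log_self hp (n / 2)
    rw [pow_succ] at this
    have h : n ≤ 4 * (p ^ Nat.log p (n / 2) * p) := by omega
    linarith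

open Filter in
/-- Quasi-polylogarithmic powers of `n` are eventually at most `2 ^ (n / (4 * p))`. -/
theorem eventually_rpow_log_div_log_log_le_two_pow {p : ℕ} (hp : 0 < p) (s : ℕ) :
    ∀ᶠ n : ℕ in atTop, ∀ q : ℕ, n ≤ 4 * p * q →
      (n : ℝ) ^ (Real.log n / Real.log (Real.log n)) ^ s ≤ (2 : ℝ) ^ q := by
  have hp' : (0 : ℝ) < p := by exact_mod_cast hp
  have hε : 0 < Real.log 2 / (4 * p) := div_pos (Real.log_pos one_lt_two) (by positivity)
  have hO := (Real.isLittleO_pow_log_id_atTop (n := s + 1)).bound hε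
  have hlog := Real.tendsto_log_atTop.eventually_ge_atTop 0
  have hloglog := (Real.tendsto_log_atTop.comp Real.tendsto_log_atTop).eventually_ge_atTop 1
  filter_upwards [tendsto_natCast_atTop_atTop.eventually hO,
    tendsto_natCast_atTop_atTop.eventually hlog, tendsto_natCast_atTop_atTop.eventually hloglog,
    eventually_gt_atTop 0] with n hO hlog hloglog hn q hq
  have hn' : (0 : ℝ) < n := by exact_mod_cast hn
  simp only [id, Function.comp_apply, Real.norm_eq_abs, abs_pow, abs_of_nonneg hlog,
    abs_of_pos hn'] at hO hloglog
  rw [← Real.log_le_log_iff (Real.rpow_pos_of_pos hn' _) (by positivity), Real.log_rpow hn',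
    Real.log_pow]
  calc (Real.log n / Real.log (Real.log n)) ^ s * Real.log n
      ≤ Real.log n ^ s * Real.log n := by
        gcongr
        exact div_le_self hlog hloglog
    _ ≤ Real.log 2 / (4 * p) * n := by rwa [← pow_succ]
    _ ≤ Real.log 2 / (4 * p) * (4 * p * q) := by
        gcongr
        exact_mod_cast hq
    _ = q * Real.log 2 := by field_simp

theorem not_dvd_prime_pow_of_one_lt_card_primeFactors {m p : ℕ} (hp : p.Prime)
    (hm : 1 < m.primeFactors.card) (k : ℕ) : ¬ m ∣ p ^ k := by
  intro h
  have hsub : m.primeFactors ⊆ {p} := fun x hx => by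
    have hx' := Nat.prime_of_mem_primeFactors hx
    exact Finset.mem_singleton.2 <| (Nat.prime_dvd_prime_iff_eq hx' hp).1 <|
      hx'.dvd_of_dvd_pow ((Nat.dvd_of_mem_primeFactors hx).trans h)
  exact (Finset.card_le_card hsub).not_gt (by simpa using hm)

theorem mainTheorem9 (m r : ℕ) (hm : 1 < m) (hm' : ¬ m.Prime) (hr : m.primeFactors.card = r) :
    ∃ c : ℝ, 0 < c ∧
      ∀ p : ℕ, p.Prime →
        ∀ g : ℕ → ℕ, IsCardinalityTransformation g → HasZeroOneModProperty p m g →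
          ∃ κ : ℕ, ∀ n : ℕ, κ ≤ n →
            (n : ℝ) ^ (c * (Real.log n / Real.log (Real.log n)) ^ (r - 1)) ≤ (g n : ℝ) := by
  refine ⟨1, one_pos, fun p hp g hg h01 => ?_⟩
  simp only [one_mul]
  rcases le_or_gt r 1 with hr1 | hr1
  · refine ⟨0, fun n _ => ?_⟩
    have hle := hg.choose_prime_pow_le hp h01 (k := 0)
      (by rw [pow_zero, Nat.dvd_one]; exact hm.ne') n
    rw [pow_zero, Nat.choose_one_right] at hle
    rw [Nat.sub_eq_zero_of_le hr1, pow_zero, Real.rpow_one]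
    exact_mod_cast hle
  · obtain ⟨κ, hκ⟩ := Filter.eventually_atTop.1
      (eventually_rpow_log_div_log_log_le_two_pow hp.pos (r - 1))
    refine ⟨max κ 2, fun n hn => ?_⟩
    obtain ⟨k, hk, hk'⟩ := Nat.exists_pow_between hp.one_lt (le_of_max_le_right hn)
    refine (hκ n (le_of_max_le_left hn) _ hk').trans ?_
    have hle : 2 ^ p ^ k ≤ g n :=
      calc 2 ^ p ^ k ≤ (p ^ k).centralBinom := Nat.two_pow_le_centralBinom _
        _ ≤ n.choose (p ^ k) := Nat.choose_le_choose _ hk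
        _ ≤ g n := hg.choose_prime_pow_le hp h01
            (not_dvd_prime_pow_of_one_lt_card_primeFactors hp (hr ▸ hr1) k) n
    exact_mod_cast hle
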